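/- Let $d\ge 0$, let $K$ be a compact connected abelian subgroup of $SO(d)$, and let $a\in K$ be such that the closed subgroup generated by $a$ is $K$. Let $(E,\mathcal A,\rho)$ be a probability space and $\tau:E\to E$ a transformation. Let $f:E\to[0,1]$ be a function that is not $\rho$-almost everywhere equal to an indicator function (that is, it is not true that $f(x)\in\{0,1\}$ for $\rho$-almost every $x$), and suppose that $g=f(1-f)$ is $\rho$-integrable and satisfies $$\sup_{x\in E}\Big|\sum_{i=1}^{n}\Big(g(\tau^i x)-\int_E g\,d\rho\Big)\Big|=o(\sqrt n)\qquad(n\to\infty).$$ Then for $\rho$-almost every $x\in E$ the following holds. Whenever $R_1,R_2,\dots$ are independent $K$-valued random variables on a probability space such that, for every $j\ge1$, the law of $R_j$ is $$f(\tau^j x)\,\delta_a+\big(1-f(\tau^j x)\big)\,\delta_{a^{-1}},$$ the products $R_1R_2\cdots R_n$ converge in law, as $n\to\infty$, to the normalized Haar measure on $K$. -/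

import Mathlib

open MeasureTheory ProbabilityTheory Filter Topology

/-- The special orthogonal group `SO(d)`, with the topology inherited from the space of real
`d × d` matrices, is a topological group. -/
instance specialOrthogonalGroup_isTopologicalGroup (d : ℕ) :
    IsTopologicalGroup (Matrix.specialOrthogonalGroup (Fin d) ℝ) where
  continuous_mul := continuous_mul
  continuous_inv :=
    Continuous.subtype_mk (continuous_star.comp continuous_subtype_val) _

/-- The normalized Haar measure of a compact group: the Haar measure giving mass one to the
whole group. -/
noncomputable def normalizedHaar (G : Type*) [TopologicalSpace G] [Group G]
    [IsTopologicalGroup G] [CompactSpace G] [MeasurableSpace G] [BorelSpace G] : Measure G :=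
  Measure.haarMeasure (⊤ : TopologicalSpace.PositiveCompacts G)

instance normalizedHaar_isProbabilityMeasure (G : Type*) [TopologicalSpace G] [Group G]
    [IsTopologicalGroup G] [CompactSpace G] [MeasurableSpace G] [BorelSpace G] :
    IsProbabilityMeasure (normalizedHaar G) :=
  ⟨Measure.haarMeasure_self (K₀ := (⊤ : TopologicalSpace.PositiveCompacts G))⟩

/-- The class `C₂(S)` of a system `S = (E, ρ, τ)`: the integrable functions `g` such that
`sup_{x ∈ E} |∑_{i=1}^{n} (g (τ^i x) - ∫ g dρ)| = o(√n)`. The little-o estimate of the supremum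
is written out as an estimate that is uniform in `x`. -/
structure InClassC2 {E : Type*} [MeasurableSpace E] (ρ : Measure E) (τ : E → E)
    (g : E → ℝ) : Prop where
  integrable : Integrable g ρ
  uniform_isLittleO : ∀ ε : ℝ, 0 < ε → ∀ᶠ n : ℕ in atTop, ∀ x : E,
    |∑ i ∈ Finset.Icc 1 n, (g (τ^[i] x) - ∫ y, g y ∂ρ)| ≤ ε * Real.sqrt n

/-- `R 1, R 2, …` are independent `G`-valued random variables on `(Ω, P)` such that `R j` takes
the value `a` with probability `f (τ^j x)` and the value `a⁻¹` with probability
`1 - f (τ^j x)`. Only the indices `j ≥ 1` matter. -/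
structure IsDynamicWalk {E Ω G : Type*} [MeasurableSpace Ω] [Group G] [MeasurableSpace G]
    (τ : E → E) (f : E → ℝ) (x : E) (a : G) (P : Measure Ω) (R : ℕ → Ω → G) : Prop where
  measurable : ∀ j, 1 ≤ j → Measurable (R j)
  indep : iIndepFun (fun i : ℕ => R (i + 1)) P
  law : ∀ j, 1 ≤ j → P.map (R j) =
    ENNReal.ofReal (f (τ^[j] x)) • Measure.dirac a +
      ENNReal.ofReal (1 - f (τ^[j] x)) • Measure.dirac a⁻¹

/-- The ordered product `R 1 * R 2 * ⋯ * R n` of random group elements. -/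
def walkProduct {Ω G : Type*} [Group G] (R : ℕ → Ω → G) (n : ℕ) (ω : Ω) : G :=
  ((List.range n).map (fun i => R (i + 1) ω)).prod

/-! Weak convergence on `K` is tested on characters. They separate points because commuting
orthogonal matrices diagonalize simultaneously over ℂ (`exists_joint_eigenvector`,
`exists_character_ne_one`). By independence the coefficient of `R 1 * ⋯ * R n` at `χ` is `∏ (p_j z +
(1 - p_j) z̄)`, with `z = χ a` and `p_j = f (τ^j x)`; each factor has squared modulus `1 - 4 (Im z)²
p_j (1 - p_j)`. For nontrivial `χ`, connectedness and density of the powers of `a` force `z ≠ ±1`,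
so the product tends to `0`, the Haar coefficient, once `∑ p_j (1 - p_j) = ∞`. This divergence holds
at every `x`: `f (1 - f)` has positive mean and the `C₂` bound makes its Birkhoff sums grow
linearly. -/

open scoped BoundedContinuousFunction

/-! ### Characters and weak convergence -/

/-- A continuous unitary character, viewed as a bounded continuous complex function. -/
noncomputable def characterFun (G : Type*) [TopologicalSpace G] [Monoid G] :
    (G →ₜ* Circle) →* (G →ᵇ ℂ) where
  toFun χ := BoundedContinuousFunction.ofNormedAddCommGroup (fun g => (χ g : ℂ))
    (continuous_subtype_val.comp χ.continuous_toFun) 1 (fun g => (Circle.norm_coe _).le)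
  map_one' := by ext; simp
  map_mul' χ ψ := by ext; simp

@[simp]
theorem characterFun_apply {G : Type*} [TopologicalSpace G] [Monoid G] (χ : G →ₜ* Circle) (g : G) :
    characterFun G χ g = (χ g : ℂ) := rfl

/-- The star algebra of trigonometric polynomials on `G`. -/
noncomputable def trigPoly (G : Type*) [TopologicalSpace G] [Monoid G] :
    StarSubalgebra ℂ (G →ᵇ ℂ) where
  toSubalgebra := Algebra.adjoin ℂ (Set.range (characterFun G))
  star_mem' := by
    change Algebra.adjoin ℂ (Set.range (characterFun G)) ≤
      star (Algebra.adjoin ℂ (Set.range (characterFun G)))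
    refine Algebra.adjoin_le ?_
    rintro - ⟨χ, rfl⟩
    refine Algebra.subset_adjoin ⟨χ⁻¹, ?_⟩
    ext g
    change (((χ g)⁻¹ : Circle) : ℂ) = starRingEnd ℂ (χ g : ℂ)
    exact Circle.coe_inv_eq_conj _

/-- No multiplicative case is needed: products of characters are characters, so the algebra they
generate is their linear span. -/
theorem trigPoly_induction {G : Type*} [TopologicalSpace G] [Monoid G] {p : (G →ᵇ ℂ) → Prop}
    (hχ : ∀ χ : G →ₜ* Circle, p (characterFun G χ)) (h0 : p 0)
    (hadd : ∀ u v, p u → p v → p (u + v)) (hsmul : ∀ (c : ℂ) u, p u → p (c • u))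
    {u : G →ᵇ ℂ} (hu : u ∈ trigPoly G) : p u := by
  have hu' : u ∈ Submodule.span ℂ
      (Submonoid.closure (Set.range (characterFun G)) : Set (G →ᵇ ℂ)) := by
    rw [← Algebra.adjoin_eq_span]; exact hu
  rw [← MonoidHom.coe_mrange, Submonoid.closure_eq] at hu'
  clear hu
  induction hu' using Submodule.span_induction with
  | mem x h => obtain ⟨χ, rfl⟩ := h; exact hχ χ
  | zero => exact h0
  | add x y _ _ hx hy => exact hadd x y hx hy
  | smul c x _ hx => exact hsmul c x hx

/-- On a compact Polish group whose characters separate points, pointwise convergence of the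
Fourier coefficients implies weak convergence. -/
theorem tendsto_of_tendsto_integral_character {G : Type*} [TopologicalSpace G] [Group G]
    [CompactSpace G] [PolishSpace G] [MeasurableSpace G] [BorelSpace G]
    (hsep : ∀ g h : G, g ≠ h → ∃ χ : G →ₜ* Circle, χ g ≠ χ h)
    {μ : ℕ → ProbabilityMeasure G} {μ₀ : ProbabilityMeasure G}
    (h : ∀ χ : G →ₜ* Circle, Tendsto (fun n => ∫ g, (χ g : ℂ) ∂(μ n : Measure G)) atTop
      (𝓝 (∫ g, (χ g : ℂ) ∂(μ₀ : Measure G)))) :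
    Tendsto μ atTop (𝓝 μ₀) := by
  refine ProbabilityMeasure.tendsto_of_tight_of_separatesPoints ℂ (A := trigPoly G) ?_ ?_ ?_
  · exact IsTightMeasureSet.of_compactSpace
  · intro g k hgk
    obtain ⟨χ, hχ⟩ := hsep g k hgk
    refine ⟨_, ⟨_, ⟨characterFun G χ, Algebra.subset_adjoin ⟨χ, rfl⟩, rfl⟩, rfl⟩, ?_⟩
    exact fun h => hχ (Circle.ext h)
  · intro u hu
    refine trigPoly_induction (p := fun u => Tendsto (fun n => ∫ x, u x ∂(μ n : Measure G)) atTop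
      (𝓝 (∫ x, u x ∂(μ₀ : Measure G)))) h (by simp) (fun u v hu hv => ?_) (fun c u hu => ?_) hu
    · have key (ν : ProbabilityMeasure G) : ∫ x, (u + v) x ∂(ν : Measure G) =
          ∫ x, u x ∂(ν : Measure G) + ∫ x, v x ∂(ν : Measure G) :=
        integral_add (u.integrable _) (v.integrable _)
      simp_rw [key]
      exact hu.add hv
    · have key (ν : ProbabilityMeasure G) : ∫ x, (c • u) x ∂(ν : Measure G) =
          c * ∫ x, u x ∂(ν : Measure G) := integral_const_mul _ _
      simp_rw [key]
      exact hu.const_mul c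

/-- A nontrivial character integrates to zero against a left-invariant measure. -/
theorem integral_character_eq_zero {G : Type*} [TopologicalSpace G] [Group G]
    [MeasurableSpace G] [MeasurableMul G] (μ : Measure G) [μ.IsMulLeftInvariant]
    {χ : G →ₜ* Circle} {k : G} (hk : χ k ≠ 1) : ∫ g, (χ g : ℂ) ∂μ = 0 := by
  -- Translating by `k` multiplies the integral by `χ k ≠ 1`.
  have h := integral_mul_left_eq_self (μ := μ) (fun g => (χ g : ℂ)) k
  simp only [map_mul, Circle.coe_mul, integral_const_mul] at h
  have h1 : ((χ k : ℂ) - 1) * ∫ g, (χ g : ℂ) ∂μ = 0 := by rw [sub_mul, h]; ring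
  refine (mul_eq_zero.1 h1).resolve_left fun h2 => hk ?_
  ext
  simpa using sub_eq_zero.1 h2

/-- On a connected group, a nontrivial character takes a value different from `1` and `-1` at every
topological generator. -/
theorem character_sq_ne_one {G : Type*} [TopologicalSpace G] [Group G] [ConnectedSpace G]
    {a : G} (ha : closure ((Subgroup.zpowers a : Subgroup G) : Set G) = Set.univ)
    {χ : G →ₜ* Circle} {k : G} (hk : χ k ≠ 1) : χ a ^ 2 ≠ 1 := by
  intro h
  have hcont : Continuous χ := χ.continuous_toFun
  have hsq : ∀ g, χ g ^ 2 = 1 := by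
    have hcl : IsClosed {g : G | χ g ^ 2 = 1} := isClosed_eq (hcont.pow 2) continuous_const
    have hsub : ((Subgroup.zpowers a : Subgroup G) : Set G) ⊆ {g : G | χ g ^ 2 = 1} := by
      rintro _ ⟨m, rfl⟩
      change χ (a ^ m) ^ 2 = 1
      rw [map_zpow, ← zpow_natCast, zpow_comm, zpow_natCast, h, one_zpow]
    intro g
    exact closure_minimal hsub hcl (ha ▸ Set.mem_univ g)
  have hval : ∀ g, (χ g : ℂ) = 1 ∨ (χ g : ℂ) = -1 := fun g =>
    sq_eq_one_iff.1 (by exact_mod_cast congrArg Subtype.val (hsq g))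
  have hclosed : IsClosed {g : G | χ g = 1} := isClosed_eq hcont continuous_const
  -- Since `χ` takes only the values `±1`, its kernel is cut out by an open condition on the real
  -- part.
  have hopen : IsOpen {g : G | χ g = 1} := by
    have : {g : G | χ g = 1} = {g : G | 0 < (χ g : ℂ).re} := by
      ext g
      rcases hval g with hg | hg
      · simp [hg, Circle.ext_iff]
      · simp only [Set.mem_ofPred_eq, Circle.ext_iff, hg]
        norm_num [Complex.ext_iff]
    rw [this]
    exact isOpen_lt continuous_const
      (Complex.continuous_re.comp (continuous_subtype_val.comp hcont))
  have huniv := IsClopen.eq_univ ⟨hclosed, hopen⟩ ⟨1, map_one χ⟩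
  exact hk (huniv ▸ Set.mem_univ k : k ∈ {g : G | χ g = 1})

/-! ### Characters of commutative subgroups of `SO(d)` -/

/-- If matrices commute with each other and with each other's adjoints, then any of them that is
not the identity has an eigenvalue `≠ 1` with a joint eigenvector of the whole family. -/
theorem exists_joint_eigenvector {ι n : Type*} [Fintype n] [DecidableEq n]
    (U : ι → Matrix n n ℂ) (hU : ∀ i j, Commute (U i) (U j))
    (hU' : ∀ i j, Commute (U i) (U j).conjTranspose)
    {i : ι} (hi : U i ≠ 1) :
    ∃ (v : EuclideanSpace ℂ n) (c : ι → ℂ), v ≠ 0 ∧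
      (∀ j, (U j).toEuclideanLin v = c j • v) ∧ c i ≠ 1 := by
  -- Twice the Hermitian part of each `U j`, and minus twice the skew part divided by `i`: a
  -- commuting Hermitian family that recovers `U j`.
  let A : ι × Bool → Matrix n n ℂ := fun p =>
    if p.2 then U p.1 + (U p.1).conjTranspose else
      Complex.I • (U p.1 - (U p.1).conjTranspose)
  have hA : ∀ p, (A p).IsHermitian := by
    rintro ⟨j, b⟩
    cases b
    · simp [A, Matrix.IsHermitian, Matrix.conjTranspose_smul]
      rw [← smul_neg, neg_sub]
    · simp [A, Matrix.IsHermitian, add_comm]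
  have hstar : ∀ i j, Commute (U i).conjTranspose (U j).conjTranspose :=
    fun i j => (hU i j).star_star
  have hstar' : ∀ i j, Commute (U i).conjTranspose (U j) := fun i j => (hU' j i).symm
  have hcomm : ∀ p q, Commute (A p) (A q) := by
    have h1 : ∀ i j, Commute (U i + (U i).conjTranspose) (U j + (U j).conjTranspose) := fun i j =>
      ((hU i j).add_right (hU' i j)).add_left ((hstar' i j).add_right (hstar i j))
    have h2 : ∀ i j, Commute (U i + (U i).conjTranspose) (U j - (U j).conjTranspose) := fun i j =>
      ((hU i j).sub_right (hU' i j)).add_left ((hstar' i j).sub_right (hstar i j))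
    have h3 : ∀ i j, Commute (U i - (U i).conjTranspose) (U j - (U j).conjTranspose) := fun i j =>
      ((hU i j).sub_right (hU' i j)).sub_left ((hstar' i j).sub_right (hstar i j))
    rintro ⟨i, b⟩ ⟨j, b'⟩
    cases b <;> cases b'
    · exact ((h3 i j).smul_right _).smul_left _
    · exact ((h2 j i).symm).smul_left _
    · exact (h2 i j).smul_right _
    · exact h1 i j
  let T : ι × Bool → Module.End ℂ (EuclideanSpace ℂ n) := fun p => (A p).toEuclideanLin
  have hT : ∀ p, (T p).IsSymmetric := fun p => Matrix.isSymmetric_toEuclideanLin_iff.2 (hA p)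
  have hTcomm : Pairwise (Function.onFun Commute T) := by
    intro p q _
    ext v k
    have := congrArg (fun M => Matrix.mulVec M v.ofLp k) (hcomm p q).eq
    simpa [T, Matrix.toLpLin_apply] using this
  have htop := LinearMap.IsSymmetric.iSup_iInf_eq_top_of_commute hT hTcomm
  have hUA : ∀ j, U j = (2⁻¹ : ℂ) • (A (j, true) - Complex.I • A (j, false)) := by
    intro j
    simp only [A, if_true, Bool.false_eq_true, if_false, smul_smul, Complex.I_mul_I]
    ext k l
    simp
    ring
  have heig : ∀ (γ : ι × Bool → ℂ) (v : EuclideanSpace ℂ n),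
      v ∈ ⨅ p, Module.End.eigenspace (T p) (γ p) → ∀ j, (U j).toEuclideanLin v =
        (2⁻¹ * (γ (j, true) - Complex.I * γ (j, false))) • v := by
    intro γ v hv j
    rw [Submodule.mem_iInf] at hv
    have h1 : (A (j, true)).toEuclideanLin v = γ (j, true) • v :=
      Module.End.mem_eigenspace_iff.1 (hv (j, true))
    have h2 : (A (j, false)).toEuclideanLin v = γ (j, false) • v :=
      Module.End.mem_eigenspace_iff.1 (hv (j, false))
    rw [hUA j, map_smul, map_sub, map_smul, LinearMap.smul_apply, LinearMap.sub_apply,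
      LinearMap.smul_apply, h1, h2]
    module
  -- Otherwise `U i` is the identity on every joint eigenspace, and these span.
  by_contra! hcon
  refine hi (Matrix.toEuclideanLin.injective ?_)
  have hle : (⊤ : Submodule ℂ (EuclideanSpace ℂ n)) ≤
      LinearMap.eqLocus (U i).toEuclideanLin (Matrix.toEuclideanLin (1 : Matrix n n ℂ)) := by
    rw [← htop]
    refine iSup_le fun γ v hv => ?_
    rw [LinearMap.mem_eqLocus]
    by_cases hv0 : v = 0
    · simp [hv0]
    have h := hcon v _ hv0 (heig γ v hv)
    rw [heig γ v hv i, h]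
    simp
  ext1 v
  exact hle (Submodule.mem_top (x := v))

/-- Continuous characters separate the points of a commutative subgroup of `SO(d)`. -/
theorem exists_character_ne_one {d : ℕ} (K : Subgroup (Matrix.specialOrthogonalGroup (Fin d) ℝ))
    [IsMulCommutative K] {k : K} (hk : k ≠ 1) : ∃ χ : K →ₜ* Circle, χ k ≠ 1 := by
  let φ : K →* Matrix (Fin d) (Fin d) ℂ :=
    ((Complex.ofRealHom.mapMatrix : Matrix (Fin d) (Fin d) ℝ →+* _) : _ →* _).comp
      ((Matrix.specialOrthogonalGroup (Fin d) ℝ).subtype.comp K.subtype)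
  have hφ_apply : ∀ (g : K) i j, φ g i j = ((g.1.1 i j : ℝ) : ℂ) := fun g i j => rfl
  have hφ_star : ∀ g : K, (φ g).conjTranspose = φ g⁻¹ := by
    intro g
    ext i j
    rw [Matrix.conjTranspose_apply, hφ_apply, hφ_apply]
    exact Complex.conj_ofReal _
  have hφ_cont : Continuous φ := by
    refine continuous_matrix fun i j => ?_
    exact Complex.continuous_ofReal.comp
      ((continuous_subtype_val.comp continuous_subtype_val).matrix_elem i j)
  have hφ_comm : ∀ g h : K, Commute (φ g) (φ h) := fun g h =>
    (show Commute g h from mul_comm' g h).map φ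
  have hφk : φ k ≠ 1 := by
    intro h
    apply hk
    ext i j
    have := congrFun (congrFun (h.trans (map_one φ).symm) i) j
    rw [hφ_apply, hφ_apply] at this
    exact_mod_cast this
  obtain ⟨v, c, hv, hc, hck⟩ := exists_joint_eigenvector (fun g => φ g) hφ_comm
    (fun g h => by rw [hφ_star]; exact hφ_comm _ _) hφk
  have hinj : ∀ {x y : ℂ}, x • v = y • v → x = y := fun h => smul_left_injective ℂ hv h
  have hc_one : c 1 = 1 := by
    apply hinj
    rw [← hc 1]
    simp
  have hc_mul : ∀ g h, c (g * h) = c g * c h := by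
    intro g h
    apply hinj
    rw [← hc, map_mul, mul_comm, mul_smul, ← hc g, ← map_smul, ← hc h]
    ext i
    simp [Matrix.toLpLin_apply]
  -- The adjoint of `φ g` is `φ g⁻¹`; with multiplicativity this puts `c g` on the unit circle.
  have hc_star : ∀ g, starRingEnd ℂ (c g) = c g⁻¹ := by
    intro g
    have h1 : inner ℂ ((φ g).toEuclideanLin v) v = inner ℂ v ((φ g⁻¹).toEuclideanLin v) := by
      rw [← hφ_star, Matrix.toEuclideanLin_conjTranspose_eq_adjoint,
        LinearMap.adjoint_inner_right]
    rw [hc g, hc g⁻¹, inner_smul_left, inner_smul_right] at h1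
    exact mul_right_cancel₀ (inner_self_ne_zero.2 hv) h1
  have hc_circle : ∀ g, c g ∈ Submonoid.unitSphere ℂ := by
    intro g
    have h1 : Complex.normSq (c g) = 1 := by
      have := Complex.mul_conj (c g)
      rw [hc_star, ← hc_mul, mul_inv_cancel, hc_one] at this
      exact_mod_cast this.symm
    rw [Complex.normSq_eq_norm_sq] at h1
    change c g ∈ Metric.sphere (0 : ℂ) 1
    rw [mem_sphere_zero_iff_norm]
    exact (pow_eq_one_iff_of_nonneg (norm_nonneg _) two_ne_zero).1 h1
  -- A nonzero coordinate of `v` expresses `c` through matrix entries, whence continuity.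
  obtain ⟨i, hvi⟩ : ∃ i, v i ≠ 0 := by
    by_contra! h
    exact hv (by ext i; simpa using h i)
  have hc_eq : c = fun g => (Matrix.mulVec (φ g) v.ofLp i) / v i := by
    funext g
    rw [eq_div_iff hvi]
    have := congrArg (fun w : EuclideanSpace ℂ (Fin d) => w i) (hc g)
    simpa [Matrix.toLpLin_apply] using this.symm
  have hc_cont : Continuous c := by
    rw [hc_eq]
    exact ((continuous_apply i).comp (hφ_cont.matrix_mulVec continuous_const)).div_const _
  refine ⟨{ toFun := fun g => ⟨c g, hc_circle g⟩
            map_one' := Circle.ext hc_one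
            map_mul' := fun g h => Circle.ext (hc_mul g h)
            continuous_toFun := hc_cont.subtype_mk _ }, fun h => hck ?_⟩
  exact congrArg Subtype.val h

theorem polishSpace_of_compactSpace (X : Type*) [TopologicalSpace X] [CompactSpace X] [T2Space X]
    [SecondCountableTopology X] : PolishSpace X := by
  let := TopologicalSpace.metrizableSpaceMetric X
  infer_instance

instance secondCountableTopology_specialOrthogonalGroup (d : ℕ) :
    SecondCountableTopology (Matrix.specialOrthogonalGroup (Fin d) ℝ) :=
  haveI : SecondCountableTopology (Matrix (Fin d) (Fin d) ℝ) :=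
    inferInstanceAs (SecondCountableTopology (Fin d → Fin d → ℝ))
  TopologicalSpace.Subtype.secondCountableTopology _

/-! ### Decay of the Fourier coefficients -/

/-- The squared modulus of a two-point mixture of `z` and its conjugate. -/
theorem normSq_mul_add_mul_conj {z : ℂ} (hz : ‖z‖ = 1) (p : ℝ) :
    ‖(p : ℂ) * z + ((1 - p : ℝ) : ℂ) * starRingEnd ℂ z‖ ^ 2 = 1 - 4 * z.im ^ 2 * (p * (1 - p)) := by
  have h : z.re ^ 2 + z.im ^ 2 = 1 := by
    rw [← one_pow 2, ← hz, Complex.sq_norm, Complex.normSq_apply]; ring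
  -- The mixture has real part `Re z` and imaginary part `(2p - 1) Im z`.
  rw [Complex.sq_norm, Complex.normSq_apply]
  simp
  linear_combination h

/-- Products of two-point mixtures of `z` and its conjugate tend to zero when the variances
are not summable. -/
theorem tendsto_prod_mul_add_mul_conj {z : ℂ} (hz : ‖z‖ = 1) (hz2 : z ^ 2 ≠ 1) {p : ℕ → ℝ}
    (hp : Tendsto (fun n => ∑ i ∈ Finset.range n, p i * (1 - p i)) atTop atTop) :
    Tendsto (fun n => ∏ i ∈ Finset.range n,
      ((p i : ℂ) * z + ((1 - p i : ℝ) : ℂ) * starRingEnd ℂ z)) atTop (𝓝 0) := by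
  have him : 0 < z.im ^ 2 := by
    refine lt_of_le_of_ne (sq_nonneg _) fun h => hz2 ?_
    have h0 : z.im = 0 := by simpa using h.symm
    have h1 : z.re ^ 2 = 1 := by
      have := Complex.sq_norm z
      rw [Complex.normSq_apply, hz, h0] at this
      linarith
    apply Complex.ext
    · simp [pow_two, h0]; linarith
    · simp [h0, pow_two]
  have hsq : Tendsto (fun n => ‖∏ i ∈ Finset.range n,
      ((p i : ℂ) * z + ((1 - p i : ℝ) : ℂ) * starRingEnd ℂ z)‖ ^ 2) atTop (𝓝 0) := by
    -- Each squared factor `1 - t` is at most `exp (-t)`.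
    have hexp : Tendsto (fun n => Real.exp (-(4 * z.im ^ 2 *
        ∑ i ∈ Finset.range n, p i * (1 - p i)))) atTop (𝓝 0) :=
      Real.tendsto_exp_neg_atTop_nhds_zero.comp (hp.const_mul_atTop (by positivity))
    refine squeeze_zero (fun n => sq_nonneg _) (fun n => ?_) hexp
    rw [norm_prod, ← Finset.prod_pow, Finset.mul_sum, ← Finset.sum_neg_distrib, Real.exp_sum]
    refine Finset.prod_le_prod (fun i _ => sq_nonneg _) fun i _ => ?_
    rw [normSq_mul_add_mul_conj hz]
    have := Real.add_one_le_exp (-(4 * z.im ^ 2 * (p i * (1 - p i))))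
    linarith
  exact tendsto_zero_iff_norm_tendsto_zero.2 (by
    simpa only [Real.sqrt_sq (norm_nonneg _), Real.sqrt_zero] using hsq.sqrt)

/-- If `g` has positive mean and is in the class `C₂`, then all its Birkhoff sums diverge. -/
theorem InClassC2.tendsto_sum_atTop {E : Type*} [MeasurableSpace E] {ρ : Measure E} {τ : E → E}
    {g : E → ℝ} (hg : InClassC2 ρ τ g) (hpos : 0 < ∫ y, g y ∂ρ) (x : E) :
    Tendsto (fun n => ∑ i ∈ Finset.range n, g (τ^[i + 1] x)) atTop atTop := by
  set m := ∫ y, g y ∂ρ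
  have hlin : Tendsto (fun n : ℕ => m / 2 * (n : ℝ)) atTop atTop :=
    tendsto_natCast_atTop_atTop.const_mul_atTop (by positivity)
  refine tendsto_atTop_mono' _ ?_ hlin
  -- With `ε = m / 2` and `√n ≤ n`, the sum is at least `n m - n m / 2`.
  filter_upwards [hg.uniform_isLittleO (m / 2) (by positivity), eventually_ge_atTop 1] with n hn h1
  have h := (abs_le.1 (hn x)).1
  have hsqrt : Real.sqrt n ≤ n := by
    rw [Real.sqrt_le_left (by positivity)]
    have : (1 : ℝ) ≤ n := by exact_mod_cast h1
    nlinarith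
  have hsum : ∑ i ∈ Finset.Icc 1 n, (g (τ^[i] x) - m) =
      ∑ i ∈ Finset.range n, g (τ^[i + 1] x) - n * m := by
    rw [← Finset.Ico_succ_right_eq_Icc, Finset.sum_Ico_eq_sum_range]
    simp [Finset.sum_sub_distrib, add_comm]
  rw [hsum] at h
  nlinarith

/-- The mean of `f (1 - f)` is positive unless `f` is almost everywhere an indicator function. -/
theorem integral_mul_one_sub_pos {E : Type*} [MeasurableSpace E] {ρ : Measure E}
    {f : E → ℝ} (hf : ∀ x, f x ∈ Set.Icc (0 : ℝ) 1)
    (hint : Integrable (fun x => f x * (1 - f x)) ρ)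
    (hind : ¬ ∀ᵐ x ∂ρ, f x = 0 ∨ f x = 1) : 0 < ∫ x, f x * (1 - f x) ∂ρ := by
  have hnn : ∀ x, 0 ≤ f x * (1 - f x) := fun x => mul_nonneg (hf x).1 (sub_nonneg.2 (hf x).2)
  refine lt_of_le_of_ne (integral_nonneg hnn) fun h => hind ?_
  filter_upwards [(integral_eq_zero_iff_of_nonneg hnn hint).1 h.symm] with x hx
  rcases mul_eq_zero.1 hx with h0 | h1
  · exact Or.inl h0
  · exact Or.inr (sub_eq_zero.1 h1).symm

/-! ### The law of the walk and the conclusion -/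

theorem map_walkProduct {Ω G H : Type*} [Group G] [CommGroup H] (χ : G →* H) (R : ℕ → Ω → G)
    (n : ℕ) (ω : Ω) : χ (walkProduct R n ω) = ∏ i ∈ Finset.range n, χ (R (i + 1) ω) := by
  induction n with
  | zero => simp [walkProduct]
  | succ n ih =>
    rw [Finset.prod_range_succ, ← ih, ← map_mul]
    simp [walkProduct, List.range_succ]

theorem measurable_walkProduct {Ω G : Type*} [MeasurableSpace Ω] [Group G] [MeasurableSpace G]
    [MeasurableMul₂ G] {R : ℕ → Ω → G} (hR : ∀ j, 1 ≤ j → Measurable (R j)) (n : ℕ) :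
    Measurable (walkProduct R n) := by
  induction n with
  | zero => exact measurable_const
  | succ n ih =>
    have : walkProduct R (n + 1) = fun ω => walkProduct R n ω * R (n + 1) ω := by
      funext ω
      simp [walkProduct, List.range_succ]
    rw [this]
    exact ih.mul (hR _ (by omega))

/-- Fourier coefficients of the law of a dynamic walk. -/
theorem IsDynamicWalk.integral_character {E Ω G : Type*} [MeasurableSpace Ω] [Group G]
    [TopologicalSpace G] [MeasurableSpace G] [BorelSpace G] {τ : E → E} {f : E → ℝ}
    (hf : ∀ x, f x ∈ Set.Icc (0 : ℝ) 1) {x : E} {a : G} {P : Measure Ω} {R : ℕ → Ω → G}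
    (hR : IsDynamicWalk τ f x a P R) (χ : G →ₜ* Circle) (n : ℕ) :
    ∫ ω, (χ (walkProduct R n ω) : ℂ) ∂P = ∏ i ∈ Finset.range n,
      ((f (τ^[i + 1] x) : ℂ) * (χ a : ℂ) +
        ((1 - f (τ^[i + 1] x) : ℝ) : ℂ) * starRingEnd ℂ (χ a : ℂ)) := by
  have hχ : Continuous fun g => (χ g : ℂ) := continuous_subtype_val.comp χ.continuous_toFun
  have hχm : Measurable fun g => (χ g : ℂ) := hχ.measurable
  have hone : ∀ j, 1 ≤ j → ∫ ω, (χ (R j ω) : ℂ) ∂P = (f (τ^[j] x) : ℂ) * (χ a : ℂ) +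
        ((1 - f (τ^[j] x) : ℝ) : ℂ) * starRingEnd ℂ (χ a : ℂ) := by
    intro j hj
    have hmap := integral_map (μ := P) (hR.measurable j hj).aemeasurable
      (f := fun g => (χ g : ℂ)) hχm.aestronglyMeasurable
    have hint : ∀ b : G, Integrable (fun g => (χ g : ℂ)) (Measure.dirac b) := fun b =>
      Integrable.of_bound hχm.aestronglyMeasurable 1
        (Eventually.of_forall fun g => (Circle.norm_coe _).le)
    rw [← hmap, hR.law j hj, integral_add_measure ((hint a).smul_measure ENNReal.ofReal_ne_top)
      ((hint a⁻¹).smul_measure ENNReal.ofReal_ne_top), integral_smul_measure, integral_smul_measure,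
      integral_dirac' _ _ hχm.stronglyMeasurable, integral_dirac' _ _ hχm.stronglyMeasurable,
      ENNReal.toReal_ofReal (hf _).1, ENNReal.toReal_ofReal (sub_nonneg.2 (hf _).2), map_inv,
      Circle.coe_inv_eq_conj, Complex.real_smul, Complex.real_smul]
  have hfin : iIndepFun (fun i : Fin n => R (i + 1)) P :=
    hR.indep.precomp Fin.val_injective
  have hcomp : iIndepFun (fun (i : Fin n) ω => (χ (R (i + 1) ω) : ℂ)) P :=
    hfin.comp (fun _ g => (χ g : ℂ)) fun _ => hχm
  have hprod := hcomp.integral_fun_prod_eq_prod_integral fun i =>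
    (hχm.comp (hR.measurable _ (by omega))).aestronglyMeasurable
  have hval : ∀ ω, (χ (walkProduct R n ω) : ℂ) = ∏ i : Fin n, (χ (R (i + 1) ω) : ℂ) := by
    intro ω
    have h := map_walkProduct (χ : G →* Circle) R n ω
    rw [← Fin.prod_univ_eq_prod_range (fun i => (χ : G →* Circle) (R (i + 1) ω)) n] at h
    have h' := congrArg Circle.coeHom h
    rw [map_prod] at h'
    exact h'
  simp_rw [hval]
  rw [hprod, ← Fin.prod_univ_eq_prod_range]
  exact Finset.prod_congr rfl fun i _ => hone _ (by omega)

theorem mainTheorem3 (d : ℕ)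
    (K : Subgroup (Matrix.specialOrthogonalGroup (Fin d) ℝ))
    [CompactSpace K] [ConnectedSpace K] [IsMulCommutative K]
    [MeasurableSpace K] [BorelSpace K]
    (a : K) (ha : closure ((Subgroup.zpowers a : Subgroup K) : Set K) = Set.univ)
    (E : Type*) [MeasurableSpace E] (ρ : Measure E) [IsProbabilityMeasure ρ] (τ : E → E)
    (f : E → ℝ) (hf : ∀ x, f x ∈ Set.Icc (0 : ℝ) 1)
    (hC2 : InClassC2 ρ τ (fun x => f x * (1 - f x)))
    (hind : ¬ ∀ᵐ x ∂ρ, f x = 0 ∨ f x = 1) :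
    ∀ᵐ x ∂ρ, ∀ (Ω : Type*) [MeasurableSpace Ω] (P : Measure Ω) [IsProbabilityMeasure P]
      (R : ℕ → Ω → K), IsDynamicWalk τ f x a P R →
        TendstoInDistribution (fun n => walkProduct R n) atTop (id : K → K) (fun _ => P)
          (normalizedHaar K) := by
  -- The `C₂` bound is uniform in `x`, so there is no exceptional null set.
  refine Eventually.of_forall fun x Ω _ P _ R hR => ?_
  have : SecondCountableTopology K :=
    IsEmbedding.subtypeVal.secondCountableTopology
  have : PolishSpace K := polishSpace_of_compactSpace K
  have hmeas := measurable_walkProduct hR.measurable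
  refine ⟨fun n => (hmeas n).aemeasurable, aemeasurable_id,
    tendsto_of_tendsto_integral_character (fun g h hgh => ?_) fun χ => ?_⟩
  · obtain ⟨χ, hχ⟩ := exists_character_ne_one K (div_ne_one.2 hgh)
    exact ⟨χ, fun h => hχ (by rw [map_div, h, div_self'])⟩
  have hχm : Measurable fun g => (χ g : ℂ) :=
    (continuous_subtype_val.comp χ.continuous_toFun).measurable
  have hmap : ∀ n, ∫ g, (χ g : ℂ) ∂(P.map (walkProduct R n)) =
      ∫ ω, (χ (walkProduct R n ω) : ℂ) ∂P := fun n =>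
    integral_map (hmeas n).aemeasurable hχm.aestronglyMeasurable
  change Tendsto (fun n => ∫ g, (χ g : ℂ) ∂(P.map (walkProduct R n))) atTop
    (𝓝 (∫ g, (χ g : ℂ) ∂((normalizedHaar K).map id)))
  simp_rw [hmap, Measure.map_id]
  -- For the trivial character both integrals equal `1`.
  by_cases hχ : ∀ k, χ k = 1
  · simp [hχ]
  obtain ⟨k, hk⟩ := not_forall.1 hχ
  have : (normalizedHaar K).IsMulLeftInvariant :=
    inferInstanceAs (Measure.haarMeasure _).IsMulLeftInvariant
  rw [integral_character_eq_zero _ hk]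
  simp_rw [hR.integral_character hf χ]
  refine tendsto_prod_mul_add_mul_conj (Circle.norm_coe _) (fun h => ?_)
    (hC2.tendsto_sum_atTop (integral_mul_one_sub_pos hf hC2.integrable hind) x)
  exact character_sq_ne_one ha hk (Circle.ext (by simpa using h))
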